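/- \textbf{Proposition.} Let $A_1=(-\tfrac12,-\tfrac{\sqrt3}2)$, $A_2=(\tfrac12,-\tfrac{\sqrt3}2)$, $A_3=(1,0)$, $A_4=(\tfrac12,\tfrac{\sqrt3}2)$, $A_5=(-\tfrac12,\tfrac{\sqrt3}2)$, $A_6=(-1,0)$ be the vertices of the regular hexagon inscribed in the unit circle, let $P$ be the uniform distribution (with respect to arc length) on the boundary of the hexagon, and let $\beta=\{A_1,\dots,A_6\}$. For a Borel probability measure $\mu$ on $\mathbb R^2$ with bounded support and a nonempty finite set $\gamma\subset\mathbb R^2$, put $V(\mu;\gamma)=\int\min_{a\in\gamma}\|x-a\|^2\,d\mu(x)$. For a nonempty closed set $S\subseteq\mathbb R^2$ (the constraint), a nonempty finite set $b\subset\mathbb R^2$ (the conditional set) and $n\ge \operatorname{card} b$, let $$V_n(\mu)=\inf\{V(\mu;\alpha\cup b):\alpha\subseteq S,\ \operatorname{card}\alpha\le n-\operatorname{card} b\}.$$ A set $\alpha\cup b$ with $\alpha$ as in this definition is called a conditional constrained optimal set of $n$-points for $\mu$ if it attains the infimum and if, for every $c\in b$, the set of points whose nearest element in $\alpha\cup b$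 is $c$ (ties allowed) has positive $\mu$-measure. Let $G=(-\tfrac{\sqrt3}2,0)$, $H=(\tfrac{\sqrt3}2,0)$, $I=(0,\tfrac12)$, let $Q$ be the uniform distribution on $GI\cup HI$, and let $U(x,y)=(\tfrac{\sqrt3}2x+\tfrac y2,\,-\tfrac x2+\tfrac{\sqrt3}2y-\tfrac12)$, an isometry with $U(A_6)=G$, $U(A_4)=H$, $U(A_5)=I$. For $P$ take the constraint to be the short diagonal $A_6A_4$ (a closed segment) and the conditional set $\beta$; for $Q$ take the constraint to be the segment $GH$ and the conditional set $\{G,H,I\}$. Below, "$\doteq$" means that the difference is less than half a unit in the last displayed decimal place (coordinatewise for points). (a) There are points $p_1\doteq(-0.803813,\,0.113269)$, $p_2\doteq(-0.607625,\,0.226538)$, $p_3\doteq(0.183013,\,0.683013)$ such that the conditional constrained optimal sets of nine points for $P$ are exactly $\alpha_9=\beta\cup\{p_1,p_2,p_3\}$ and its mirror image in the perpendicular bisector $y=-\sqrt3\,x$ of $A_6A_4$. They are exactly the sets $U^{-1}(\gamma_6)\cup\beta$ with $\gamma_6$ a conditional constrained optimal set of six points for $Q$, and $$V_9(P)=\tfrac13V_6(Q)+\tfrac1{18},\qquad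 V_6(Q)\doteq0.0422866,\qquad V_9(P)\doteq0.0696511.$$ (b) There are points $q_1\doteq(-0.803813,\,0.113269)$, $q_2\doteq(-0.607625,\,0.226538)$, $q_3\doteq(0.107625,\,0.639488)$, $q_4\doteq(0.303813,\,0.752757)$ such that $\alpha_{10}=\beta\cup\{q_1,q_2,q_3,q_4\}$ is the unique conditional constrained optimal set of ten points for $P$. A set is a conditional constrained optimal set of ten points for $P$ if and only if it equals $U^{-1}(\gamma_7)\cup\beta$ for some conditional constrained optimal set $\gamma_7$ of seven points for $Q$. Moreover $$V_{10}(P)=\tfrac13V_7(Q)+\tfrac1{18},\qquad V_7(Q)\doteq0.0399150,\qquad V_{10}(P)\doteq0.0688606.$$ -/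

import Mathlib

open MeasureTheory Set
open scoped ENNReal

noncomputable section

/-- The plane `ℝ²` with its Euclidean distance and its Borel σ-algebra. -/
abbrev Plane : Type := EuclideanSpace ℝ (Fin 2)

/-- The distortion error `V(P; γ) = ∫ min_{a ∈ γ} d(x, a)² dP(x)`
(used for nonempty finite `γ`, where the infimum is a minimum). -/
def distortionError (P : Measure Plane) (γ : Set Plane) : ℝ :=
  ∫ x, (⨅ a : γ, dist x (a : Plane) ^ 2) ∂P

/-- The `n`-th conditional constrained quantization error for `P` with constraint `S` and
(nonempty, finite) conditional set `β`: the infimum of `V(P; α ∪ β)` over all `α ⊆ S` having at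
most `n - card β` elements (used for `n ≥ card β`). -/
def condConstrainedError (P : Measure Plane) (S β : Set Plane) (n : ℕ) : ℝ :=
  sInf {v : ℝ | ∃ α : Set Plane, α ⊆ S ∧ α.Finite ∧ α.ncard + β.ncard ≤ n ∧
    v = distortionError P (α ∪ β)}

/-- The Voronoi region `M(a | γ)`: the points which are nearest to `a` among the elements of
`γ`. -/
def voronoiRegion (a : Plane) (γ : Set Plane) : Set Plane :=
  {x : Plane | ∀ b ∈ γ, dist x a ≤ dist x b}

/-- `γ` is a conditional constrained optimal set of `n`-points for `P`, with constraint `S` and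
conditional set `β`: `γ = α ∪ β` for some `α ⊆ S` with at most `n - card β` elements, the Voronoi
regions of the elements of `β` have positive probability, and the infimum defining the `n`-th
conditional constrained quantization error is attained at `γ`. -/
def IsCondOptimalSet (P : Measure Plane) (S β : Set Plane) (n : ℕ) (γ : Set Plane) : Prop :=
  (∃ α : Set Plane, α ⊆ S ∧ α.Finite ∧ α.ncard + β.ncard ≤ n ∧ γ = α ∪ β) ∧
  (∀ b ∈ β, 0 < P (voronoiRegion b γ)) ∧
  distortionError P γ = condConstrainedError P S β n

/-- The uniform probability distribution on the segment from `a` to `b`. -/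
def segmentUniform (a b : Plane) : Measure Plane :=
  (volume.restrict (Icc (0 : ℝ) 1)).map (fun t : ℝ => AffineMap.lineMap a b t)

/-- The vertices `A₁, …, A₆` (indexed by `0, …, 5`) of the regular hexagon inscribed in the unit
circle. -/
def hexVertex : Fin 6 → Plane :=
  ![!₂[-1 / 2, -√3 / 2], !₂[1 / 2, -√3 / 2], !₂[1, 0],
    !₂[1 / 2, √3 / 2], !₂[-1 / 2, √3 / 2], !₂[-1, 0]]

/-- The conditional set `β` of all vertices of the hexagon. -/
def hexVertices : Set Plane := Set.range hexVertex

/-- The uniform distribution `P` on the boundary of the hexagon. The six sides have length one, so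
each of them carries mass `1/6` distributed uniformly; `j + 1` is taken modulo `6`. -/
def hexUniform : Measure Plane :=
  (1 / 6 : ℝ≥0∞) • ∑ j : Fin 6, segmentUniform (hexVertex j) (hexVertex (j + 1))

/-- The short diagonal `A₆A₄`. -/
def shortDiagonal : Set Plane := segment ℝ (hexVertex 5) (hexVertex 3)

/-- The isometry `U` which carries the triangle `A₆A₄A₅` onto the triangle `GHI`. -/
def isometryU (p : Plane) : Plane :=
  !₂[√3 / 2 * p 0 + p 1 / 2, -(p 0) / 2 + √3 / 2 * p 1 - 1 / 2]

/-- The vertex `G` of the triangle `GHI`. -/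
def triG : Plane := !₂[-√3 / 2, 0]

/-- The vertex `H` of the triangle `GHI`. -/
def triH : Plane := !₂[√3 / 2, 0]

/-- The vertex `I` of the triangle `GHI`. -/
def triI : Plane := !₂[0, 1 / 2]

/-- The uniform distribution `Q` on `GI ∪ HI`; both sides have length one. -/
def triUniform : Measure Plane :=
  (1 / 2 : ℝ≥0∞) • (segmentUniform triG triI + segmentUniform triH triI)

/-- The reflection in the line `y = -√3 x`, which is the perpendicular bisector of `A₆A₄`. -/
def diagReflection (p : Plane) : Plane :=
  !₂[-(p 0 + √3 * p 1) / 2, (p 1 - √3 * p 0) / 2]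

/-- Both coordinates of `p` agree with the decimals `x`, `y` to within half a unit in the sixth
decimal place. -/
def RoundsTo (p : Plane) (x y : ℝ) : Prop :=
  |p 0 - x| < 5 / 10 ^ 7 ∧ |p 1 - y| < 5 / 10 ^ 7

end

/-! ### Integrals of piecewise affine functions -/

/-! Let `t` in [0,1] be the distance from `triG` to a point of the side GI. Its squared distance is
t² to G, t² - (2t - 1) to I, and t² - 3x(t - x) to the point of parameter x on the base GH. Hence
the cost of the side is 1/3 minus the integral of a maximum of affine "gains", and the best
configuration maximises that integral.

The two sides decouple. A base point with x ≥ 1/2 never gains more on GI than G and I together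
(`chordGain_le_apexGain`), so each base point is useful only to the side in whose half it lies. It
remains to solve the problem on one side with k points and to distribute the points.

With no point the cost is 1/12. With one point the gain is a rational function of x, with maximum at
`soloParam`. For x < y, the point x adds at most 3xy(y - x)/2 to the gain of y; this is largest at x
= y/2, and the remaining function of y is maximal at `2 * pairParam`. With any number of points, the
cost is at least 1/27, by the envelope 3t²/4 of the lines 3x(t - x). Numerically these values force
the split 2 + 1 for three points (hence two mirror images) and 2 + 2 for four points
(`totalCost_three`, `totalCost_four`).

On the other four sides of the hexagon no diagonal point and no other vertex beats the endpoints, so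
each costs 1/12. The remaining two sides are carried by U to the triangle, whence
`distortionError_hexSet`. `optimal_of_params` turns the statements on parameters into statements on
optimal sets. -/

theorem integral_affine (c d a b : ℝ) :
    ∫ t in a..b, (c * t + d) = c * (b ^ 2 - a ^ 2) / 2 + d * (b - a) := by
  rw [intervalIntegral.integral_add
      (Continuous.intervalIntegrable (by fun_prop) _ _)
      (Continuous.intervalIntegrable (by fun_prop) _ _),
    intervalIntegral.integral_const_mul, integral_id, intervalIntegral.integral_const, smul_eq_mul]
  ring

theorem integral_eq_affine {f : ℝ → ℝ} {c d a b : ℝ} (hab : a ≤ b)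
    (h : ∀ t, a ≤ t → t ≤ b → f t = c * t + d) :
    ∫ t in a..b, f t = c * (b ^ 2 - a ^ 2) / 2 + d * (b - a) := by
  rw [← integral_affine]
  refine intervalIntegral.integral_congr fun t ht => ?_
  rw [uIcc_of_le hab] at ht
  exact h t ht.1 ht.2

theorem integral_split_three {f : ℝ → ℝ} (hf : Continuous f) (x y : ℝ) :
    ∫ t in (0 : ℝ)..1, f t
      = (∫ t in (0 : ℝ)..x, f t) + (∫ t in x..y, f t) + ∫ t in y..1, f t := by
  rw [intervalIntegral.integral_add_adjacent_intervals (hf.intervalIntegrable _ _)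
    (hf.intervalIntegrable _ _), intervalIntegral.integral_add_adjacent_intervals
    (hf.intervalIntegrable _ _) (hf.intervalIntegrable _ _)]

/-- What the apex `I` gains over the vertex `G` at distance `t` from `G`. -/
noncomputable def apexGain (t : ℝ) : ℝ := max 0 (2 * t - 1)

/-- What the point of parameter `x` on the base gains over the vertex `G`. -/
noncomputable def chordGain (x t : ℝ) : ℝ := 3 * x * (t - x)

/-- The extra gain of a point of parameter `x` in the presence of one of parameter `y`. -/
noncomputable def extraGain (x y t : ℝ) : ℝ :=
  max (max 0 (chordGain x t)) (chordGain y t) - max 0 (chordGain y t)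

/-- The integrated gain of a single point of parameter `x`. -/
noncomputable def singleGain (x : ℝ) : ℝ := 3 * x * (1 - 2 * x) ^ 2 / (4 * (2 - 3 * x))

@[fun_prop] theorem continuous_apexGain : Continuous apexGain := by unfold apexGain; fun_prop

@[fun_prop] theorem continuous_chordGain (x : ℝ) : Continuous (chordGain x) := by
  unfold chordGain; fun_prop

@[fun_prop] theorem continuous_extraGain (x y : ℝ) : Continuous (extraGain x y) := by
  unfold extraGain; fun_prop

theorem integral_apexGain : ∫ t in (0 : ℝ)..1, apexGain t = 1 / 4 := by
  -- A single breakpoint suffices; the middle interval is degenerate.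
  rw [integral_split_three continuous_apexGain (1 / 2) (1 / 2),
    integral_eq_affine (c := 0) (d := 0) (by norm_num) (fun t _ h => ?_),
    integral_eq_affine (a := 1 / 2) (b := 1 / 2) (c := 0) (d := 0) (by norm_num) (fun t _ h => ?_),
    integral_eq_affine (c := 2) (d := -1) (by norm_num) (fun t h _ => ?_)]
  · norm_num
  · rw [apexGain, max_eq_right (by linarith)]; ring
  · rw [apexGain, max_eq_left (by linarith)]; ring
  · rw [apexGain, max_eq_left (by linarith)]; ring

theorem integral_max_apexGain_chordGain {x : ℝ} (h0 : 0 ≤ x) (h1 : x ≤ 1 / 2) :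
    ∫ t in (0 : ℝ)..1, max (apexGain t) (chordGain x t) = 1 / 4 + singleGain x := by
  have hd : 0 < 2 - 3 * x := by linarith
  -- `s` is where the line 3x(t - x) meets the apex line 2t - 1.
  obtain ⟨s, hs⟩ : ∃ s, s = (1 - 3 * x ^ 2) / (2 - 3 * x) := ⟨_, rfl⟩
  have hs' : s * (2 - 3 * x) = 1 - 3 * x ^ 2 := by rw [hs]; field_simp
  have hd' : 2 - 3 * x ≠ 0 := hd.ne'
  have hs1 : s ≤ 1 := by rw [hs, div_le_one hd]; nlinarith
  have hs2 : 1 / 2 ≤ s := by rw [hs, le_div_iff₀ hd]; nlinarith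
  rw [integral_split_three (by fun_prop) x s,
    integral_eq_affine (c := 0) (d := 0) h0 (fun t _ h => ?_),
    integral_eq_affine (c := 3 * x) (d := - 3 * x ^ 2) (by linarith) (fun t h h' => ?_),
    integral_eq_affine (c := 2) (d := -1) hs1 (fun t h _ => ?_)]
  · have hg : singleGain x = s * (1 - 3 * x ^ 2) / 2 + 3 / 2 * x ^ 3 - 1 / 4 := by
      rw [singleGain, div_eq_iff (mul_ne_zero four_ne_zero hd')]
      linear_combination (-2 * (1 - 3 * x ^ 2)) * hs'
    linear_combination (-s / 2) * hs' - hg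
  · rw [apexGain, chordGain, max_eq_right (b := 2 * t - 1) (by linarith), max_eq_left]
    · ring
    · nlinarith
  · rw [apexGain, chordGain, max_eq_right]
    · ring
    · refine max_le (by nlinarith) ?_
      nlinarith
  · rw [apexGain, chordGain, max_eq_left (a := 0) (by linarith), max_eq_left]
    · ring
    · nlinarith

theorem integral_extraGain {x y : ℝ} (h0 : 0 ≤ x) (hxy : x ≤ y) (h1 : y ≤ 1 / 2) :
    ∫ t in (0 : ℝ)..1, extraGain x y t = 3 / 2 * (x * y * (y - x)) := by
  -- The lines of x and y vanish at t = x and t = y and cross at t = x + y, which is at most 1. The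
  -- extra gain is therefore a tent on [x, x + y] with its peak at y.
  rw [← intervalIntegral.integral_add_adjacent_intervals (b := x + y)
      (Continuous.intervalIntegrable (by fun_prop) _ _)
      (Continuous.intervalIntegrable (by fun_prop) _ _),
    ← intervalIntegral.integral_add_adjacent_intervals (b := y)
      (Continuous.intervalIntegrable (by fun_prop) _ _)
      (Continuous.intervalIntegrable (by fun_prop) _ _),
    ← intervalIntegral.integral_add_adjacent_intervals (b := x)
      (Continuous.intervalIntegrable (by fun_prop) _ _)
      (Continuous.intervalIntegrable (by fun_prop) _ _),
    integral_eq_affine (c := 0) (d := 0) h0 (fun t _ h => ?_),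
    integral_eq_affine (c := 3 * x) (d := - 3 * x ^ 2) hxy (fun t h h' => ?_),
    integral_eq_affine (a := y) (b := x + y) (c := 3 * x - 3 * y) (d := 3 * y ^ 2 - 3 * x ^ 2)
      (by linarith) (fun t h h' => ?_),
    integral_eq_affine (c := 0) (d := 0) (by linarith) (fun t h _ => ?_)]
  · ring
  · rw [extraGain, chordGain, chordGain, max_assoc, max_eq_right (b := 3 * y * (t - y)),
      max_eq_right (b := 3 * y * (t - y))] <;> nlinarith
  · have h2 : 3 * x * (t - x) - 3 * y * (t - y) = 3 * (y - x) * (x + y - t) := by ring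
    have h3 : 0 ≤ (y - x) * (x + y - t) := mul_nonneg (by linarith) (by linarith)
    rw [extraGain, chordGain, chordGain, max_eq_right (b := 3 * x * (t - x)),
      max_eq_right (a := 0) (b := 3 * y * (t - y)), max_eq_left] <;> nlinarith
  · rw [extraGain, chordGain, chordGain, max_eq_right (b := 3 * x * (t - x)),
      max_eq_left (b := 3 * y * (t - y)), max_eq_left] <;> nlinarith
  · rw [extraGain, chordGain, chordGain, max_eq_left (b := 3 * x * (t - x)),
      max_eq_left (b := 3 * y * (t - y))] <;> nlinarith

theorem max_chordGain_le (x y t : ℝ) :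
    max (max (apexGain t) (chordGain y t)) (chordGain x t) ≤
      max (apexGain t) (chordGain y t) + extraGain x y t := by
  unfold apexGain extraGain
  generalize chordGain x t = p, chordGain y t = q, 2 * t - 1 = r
  grind

/-- The extra gain vanishes for t ≥ x + y, whereas the apex contributes only for t > 1/2. Under x +
y ≤ 1/2 the two never compete, so the general inequality `max_chordGain_le` is sharp. -/
theorem max_chordGain_eq {x y t : ℝ} (hxy : x ≤ y) (h : x + y ≤ 1 / 2) :
    max (max (apexGain t) (chordGain y t)) (chordGain x t) =
      max (apexGain t) (chordGain y t) + extraGain x y t := by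
  refine le_antisymm (max_chordGain_le x y t) ?_
  have : chordGain x t ≤ chordGain y t ∨ 2 * t - 1 ≤ 0 := by
    by_cases ht : t ≤ x + y
    · right; linarith
    · left; unfold chordGain; nlinarith
  unfold apexGain extraGain
  generalize chordGain x t = p at *
  generalize chordGain y t = q at *
  generalize 2 * t - 1 = r at *
  grind

/-- For x ≥ 1/2 ≥ t/2 the gain decreases in x, so the midpoint of the base is the best such point,
and its gain is 3/4 of 2t - 1. -/
theorem chordGain_le_apexGain {x t : ℝ} (hx : 1 / 2 ≤ x) (ht1 : t ≤ 1) :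
    chordGain x t ≤ apexGain t := by
  unfold chordGain apexGain
  rcases le_total t (1 / 2) with h | h
  · exact le_max_of_le_left (by nlinarith)
  · exact le_max_of_le_right (by nlinarith)

/-- For fixed t the gain is a concave quadratic in x with vertex x = t/2; the bound is the envelope
of all the lines. -/
theorem chordGain_le_sq (x t : ℝ) : chordGain x t ≤ 3 / 4 * t ^ 2 := by
  unfold chordGain; nlinarith [sq_nonneg (t - 2 * x)]

theorem integral_max_sq : ∫ t in (0 : ℝ)..1, max (3 / 4 * t ^ 2) (2 * t - 1) = 8 / 27 := by
  -- The envelope meets the apex line at the roots 2/3 and 2 of 3t² - 8t + 4.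
  rw [← intervalIntegral.integral_add_adjacent_intervals (b := 2 / 3)
      (Continuous.intervalIntegrable (by fun_prop) _ _)
      (Continuous.intervalIntegrable (by fun_prop) _ _),
    integral_eq_affine (a := 2 / 3) (c := 2) (d := -1) (by norm_num) (fun t h h' => ?_)]
  · have : ∫ t in (0 : ℝ)..(2 / 3), max (3 / 4 * t ^ 2) (2 * t - 1)
        = ∫ t in (0 : ℝ)..(2 / 3), 3 / 4 * t ^ 2 := by
      refine intervalIntegral.integral_congr fun t ht => ?_
      rw [uIcc_of_le (by norm_num)] at ht
      exact max_eq_left (by nlinarith [ht.1, ht.2])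
    rw [this, intervalIntegral.integral_const_mul, integral_pow]
    norm_num
  · rw [max_eq_right] <;> nlinarith [mul_nonneg (sub_nonneg.2 h) (sub_nonneg.2 h')]

/-! ### The optimal parameters -/

/-- The parameter of the optimal single point. -/
noncomputable def soloParam : ℝ := (3 - √3) / 6

/-- The smaller parameter of the optimal pair of points; the other one is twice as large. -/
noncomputable def pairParam : ℝ := (5 - √7) / 18

/-- The least cost of a side with one point. -/
noncomputable def soloCost : ℝ := (2 - √3) / 6

/-- The least cost of a side with two points. -/
noncomputable def pairCost : ℝ := (112 - 35 * √7) / 486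

theorem sqrt_three_bounds : 1.732050807 < √3 ∧ √3 < 1.732050808 :=
  ⟨Real.lt_sqrt_of_sq_lt (by norm_num), (Real.sqrt_lt' (by norm_num)).2 (by norm_num)⟩

theorem sqrt_seven_bounds : 2.645751311 < √7 ∧ √7 < 2.645751312 :=
  ⟨Real.lt_sqrt_of_sq_lt (by norm_num), (Real.sqrt_lt' (by norm_num)).2 (by norm_num)⟩

theorem soloParam_bounds : 0.211 < soloParam ∧ soloParam < 0.212 := by
  unfold soloParam
  constructor <;> linarith [sqrt_three_bounds.1, sqrt_three_bounds.2]

theorem pairParam_bounds : 0.130 < pairParam ∧ pairParam < 0.131 := by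
  unfold pairParam
  constructor <;> linarith [sqrt_seven_bounds.1, sqrt_seven_bounds.2]

theorem soloCost_bounds : 0.044658198 < soloCost ∧ soloCost < 0.044658199 := by
  unfold soloCost
  constructor <;> linarith [sqrt_three_bounds.1, sqrt_three_bounds.2]

theorem pairCost_bounds : 0.039915028 < pairCost ∧ pairCost < 0.039915030 := by
  unfold pairCost
  constructor <;> linarith [sqrt_seven_bounds.1, sqrt_seven_bounds.2]

/-- The maximum at `soloParam` appears as a double root. The remaining linear factor vanishes only
at √3/3 > 1/2, so optimality and uniqueness can both be read off. -/
theorem singleGain_identity {x : ℝ} (h1 : x ≤ 1 / 2) :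
    (1 / 12 - soloCost) - singleGain x
      = 3 * (x - soloParam) ^ 2 * (√3 / 3 - x) / (2 - 3 * x) := by
  have hd : (2 - 3 * x) ≠ 0 := by linarith
  have h3 : √3 ^ 2 = 3 := Real.sq_sqrt (by norm_num)
  unfold singleGain soloCost soloParam
  field_simp
  generalize √3 = s at *
  have h3' : s ^ 3 = 3 * s := by rw [pow_succ, h3]
  ring_nf
  rw [h3', h3]
  ring

theorem singleGain_le {x : ℝ} (h1 : x ≤ 1 / 2) : singleGain x ≤ 1 / 12 - soloCost := by
  have := singleGain_identity h1
  have : 0 ≤ 3 * (x - soloParam) ^ 2 * (√3 / 3 - x) / (2 - 3 * x) :=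
    div_nonneg (mul_nonneg (by positivity) (by linarith [sqrt_three_bounds.1])) (by linarith)
  linarith

theorem eq_soloParam_of_le {x : ℝ} (h1 : x ≤ 1 / 2) (h : 1 / 12 - soloCost ≤ singleGain x) :
    x = soloParam := by
  by_contra hne
  have := singleGain_identity h1
  have hne' : 0 < (x - soloParam) ^ 2 := by
    have : x - soloParam ≠ 0 := sub_ne_zero.2 hne
    positivity
  have : 0 < 3 * (x - soloParam) ^ 2 * (√3 / 3 - x) / (2 - 3 * x) :=
    div_pos (mul_pos (by positivity) (by linarith [sqrt_three_bounds.1])) (by linarith)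
  linarith

theorem singleGain_soloParam : singleGain soloParam = 1 / 12 - soloCost := by
  have := singleGain_identity (x := soloParam) (by linarith [soloParam_bounds.2])
  simp at this
  linarith

/-- The term 3y³/8 is the contribution of the smaller point at its best position y/2; the maximum at
`2 * pairParam` is again a double root. -/
theorem pairGain_identity {y : ℝ} (h1 : y ≤ 1 / 2) :
    (1 / 12 - pairCost) - (singleGain y + 3 / 8 * y ^ 3)
      = (y - 2 * pairParam) ^ 2 * (9 * y ^ 2 - (20 + 2 * √7) * y + (4 + 10 * √7) / 3)
        / (8 * (2 - 3 * y)) := by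
  have hd : (2 - 3 * y) ≠ 0 := by linarith
  have h7 : √7 ^ 2 = 7 := Real.sq_sqrt (by norm_num)
  unfold singleGain pairCost pairParam
  field_simp
  generalize √7 = s at *
  have h7' : s ^ 3 = 7 * s := by rw [pow_succ, h7]
  ring_nf
  rw [h7', h7]
  ring

/-- The quadratic factor is still positive at 7/15 but negative at 1/2, because near 1/2 the
estimate of the pair gain counts gain already supplied by the apex. Hence the cutoff; larger y need
another argument. -/
theorem pairGain_pos {y : ℝ} (h0 : 0 ≤ y) (h1 : y ≤ 7 / 15) :
    0 < (9 * y ^ 2 - (20 + 2 * √7) * y + (4 + 10 * √7) / 3) / (8 * (2 - 3 * y)) := by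
  refine div_pos ?_ (by linarith)
  nlinarith [sqrt_seven_bounds.1, sqrt_seven_bounds.2]

theorem le_pair_gain {x y : ℝ} (hy : 0 ≤ y) :
    3 / 2 * (x * y * (y - x)) = 3 / 8 * y ^ 3 - 3 / 2 * y * (x - y / 2) ^ 2 ∧
      0 ≤ 3 / 2 * y * (x - y / 2) ^ 2 :=
  ⟨by ring, by positivity⟩

theorem pairGain_le {x y : ℝ} (h0 : 0 ≤ y) (h1 : y ≤ 7 / 15) :
    singleGain y + 3 / 2 * (x * y * (y - x)) ≤ 1 / 12 - pairCost := by
  have h2 := pairGain_identity (y := y) (by linarith)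
  have h3 := mul_nonneg (sq_nonneg (y - 2 * pairParam)) (pairGain_pos h0 h1).le
  have h4 := le_pair_gain (x := x) h0
  rw [mul_div_assoc] at h2
  linarith

theorem eq_pairParam_of_le {x y : ℝ} (h0 : 0 ≤ y) (h1 : y ≤ 7 / 15)
    (h : 1 / 12 - pairCost ≤ singleGain y + 3 / 2 * (x * y * (y - x))) :
    x = pairParam ∧ y = 2 * pairParam := by
  have h2 := pairGain_identity (y := y) (by linarith)
  have h3 := pairGain_pos h0 h1
  have h4 := le_pair_gain (x := x) h0
  rw [mul_div_assoc] at h2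
  have h5 : (y - 2 * pairParam) ^ 2 = 0 := by
    by_contra hne
    have := mul_pos (lt_of_le_of_ne (sq_nonneg (y - 2 * pairParam)) (Ne.symm hne)) h3
    linarith
  have h6 : y = 2 * pairParam := by
    have := pow_eq_zero_iff (two_ne_zero) |>.1 h5
    linarith
  refine ⟨?_, h6⟩
  rw [h5, zero_mul] at h2
  have h7 : y * (x - y / 2) ^ 2 = 0 := le_antisymm (by nlinarith) (by positivity)
  have h8 : y ≠ 0 := by rw [h6]; linarith [pairParam_bounds.1]
  have h9 := pow_eq_zero_iff (two_ne_zero) |>.1 ((mul_eq_zero.1 h7).resolve_left h8)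
  linarith

theorem singleGain_le_of_seven_fifteenths_le {y : ℝ} (h0 : 7 / 15 ≤ y) (h1 : y ≤ 1 / 2) :
    singleGain y ≤ 1 / 250 := by
  unfold singleGain
  rw [div_le_iff₀ (by linarith)]
  nlinarith [mul_nonneg (sub_nonneg.2 h0) (sub_nonneg.2 h1)]

theorem pairGain_pairParam :
    singleGain (2 * pairParam) +
      3 / 2 * (pairParam * (2 * pairParam) * (2 * pairParam - pairParam)) =
        1 / 12 - pairCost := by
  have := pairGain_identity (y := 2 * pairParam) (by linarith [pairParam_bounds.2])
  simp at this
  linarith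

/-! ### Distances in the plane -/

theorem plane_dist_sq (p q : Plane) : dist p q ^ 2 = (p 0 - q 0) ^ 2 + (p 1 - q 1) ^ 2 := by
  rw [EuclideanSpace.dist_eq, Real.sq_sqrt (by positivity), Fin.sum_univ_two, Real.dist_eq,
    Real.dist_eq, sq_abs, sq_abs]

theorem plane_isometry {f : Plane → Plane}
    (h : ∀ p q, (f p 0 - f q 0) ^ 2 + (f p 1 - f q 1) ^ 2 = (p 0 - q 0) ^ 2 + (p 1 - q 1) ^ 2) :
    Isometry f := by
  refine Isometry.of_dist_eq fun p q => ?_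
  have := h p q
  rw [← plane_dist_sq, ← plane_dist_sq] at this
  exact (pow_left_inj₀ dist_nonneg dist_nonneg two_ne_zero).1 this

theorem plane_lineMap (a b : Plane) (t : ℝ) (i : Fin 2) :
    (AffineMap.lineMap a b t : Plane) i = a i + t * (b i - a i) := by
  simp [AffineMap.lineMap_apply]
  ring

theorem plane_ext {p q : Plane} (h0 : p 0 = q 0) (h1 : p 1 = q 1) : p = q := by
  ext i
  fin_cases i
  · exact h0
  · exact h1

/-! ### The distortion error as a sum of integrals over segments -/

/-- Rewriting with `Metric.infDist` makes continuity and invariance under isometries available. -/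
theorem iInf_dist_sq {γ : Set Plane} (h : γ.Nonempty) (x : Plane) :
    ⨅ a : γ, dist x (a : Plane) ^ 2 = Metric.infDist x γ ^ 2 := by
  have : Nonempty γ := h.to_subtype
  have hb : BddBelow (range fun a : γ => dist x (a : Plane) ^ 2) :=
    ⟨0, by rintro _ ⟨a, rfl⟩; positivity⟩
  refine le_antisymm ?_ (le_ciInf fun a => ?_)
  · rw [← Real.sqrt_le_left Metric.infDist_nonneg, Metric.le_infDist h]
    intro y hy
    exact Real.sqrt_le_iff.2 ⟨dist_nonneg, ciInf_le hb ⟨y, hy⟩⟩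
  · have := Metric.infDist_le_dist_of_mem (x := x) a.2
    have := Metric.infDist_nonneg (x := x) (s := γ)
    gcongr

theorem le_infDist_sq {γ : Set Plane} (h : γ.Nonempty) {x : Plane} {r : ℝ}
    (hr : ∀ y ∈ γ, r ≤ dist x y ^ 2) : r ≤ Metric.infDist x γ ^ 2 := by
  have : Nonempty γ := h.to_subtype
  rw [← iInf_dist_sq h]
  exact le_ciInf fun a => hr a a.2

theorem infDist_sq_le {γ : Set Plane} {x y : Plane} (hy : y ∈ γ) :
    Metric.infDist x γ ^ 2 ≤ dist x y ^ 2 := by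
  have := Metric.infDist_le_dist_of_mem (x := x) hy
  have := Metric.infDist_nonneg (x := x) (s := γ)
  gcongr

/-- The integral of the squared distance to `γ` along the segment from `a` to `b`. -/
noncomputable def sideCost (γ : Set Plane) (a b : Plane) : ℝ :=
  ∫ t in (0 : ℝ)..1, Metric.infDist (AffineMap.lineMap a b t : Plane) γ ^ 2

theorem continuous_infDist_lineMap (γ : Set Plane) (a b : Plane) :
    Continuous fun t : ℝ => Metric.infDist (AffineMap.lineMap a b t : Plane) γ ^ 2 :=
  ((Metric.continuous_infDist_pt γ).comp AffineMap.lineMap_continuous).pow 2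

theorem sideCost_comm (γ : Set Plane) (a b : Plane) : sideCost γ a b = sideCost γ b a := by
  have := intervalIntegral.integral_comp_sub_left (a := 0) (b := 1)
    (fun t : ℝ => Metric.infDist (AffineMap.lineMap a b t : Plane) γ ^ 2) 1
  simp only [sub_self, sub_zero, AffineMap.lineMap_apply_one_sub] at this
  exact this.symm

theorem integral_segmentUniform (γ : Set Plane) (a b : Plane) :
    ∫ x, Metric.infDist x γ ^ 2 ∂(segmentUniform a b) = sideCost γ a b := by
  have hc : Continuous fun x : Plane => Metric.infDist x γ ^ 2 :=
    (Metric.continuous_infDist_pt γ).pow 2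
  rw [segmentUniform, integral_map (AffineMap.lineMap_continuous.aemeasurable)
    hc.aestronglyMeasurable, sideCost, intervalIntegral.integral_of_le zero_le_one,
    integral_Icc_eq_integral_Ioc]

theorem integrable_segmentUniform (γ : Set Plane) (a b : Plane) :
    Integrable (fun x => Metric.infDist x γ ^ 2) (segmentUniform a b) := by
  have hc : Continuous fun x : Plane => Metric.infDist x γ ^ 2 :=
    (Metric.continuous_infDist_pt γ).pow 2
  rw [segmentUniform, integrable_map_measure hc.aestronglyMeasurable
    (AffineMap.lineMap_continuous.aemeasurable)]
  exact (continuous_infDist_lineMap γ a b).integrableOn_Icc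

theorem distortionError_triUniform {γ : Set Plane} (h : γ.Nonempty) :
    distortionError triUniform γ = (sideCost γ triG triI + sideCost γ triH triI) / 2 := by
  simp only [distortionError, iInf_dist_sq h, triUniform]
  rw [integral_smul_measure, integral_add_measure (integrable_segmentUniform _ _ _)
    (integrable_segmentUniform _ _ _), integral_segmentUniform, integral_segmentUniform]
  simp
  ring

theorem distortionError_hexUniform {γ : Set Plane} (h : γ.Nonempty) :
    distortionError hexUniform γ =
      (∑ j : Fin 6, sideCost γ (hexVertex j) (hexVertex (j + 1))) / 6 := by
  simp only [distortionError, iInf_dist_sq h, hexUniform]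
  rw [integral_smul_measure, integral_finsetSum_measure
    fun _ _ => integrable_segmentUniform _ _ _]
  simp only [integral_segmentUniform]
  simp
  ring

/-! ### Positivity of the Voronoi regions -/

/-- At `b` itself the distance to `b` is strictly smaller than to each of the finitely many other
points, and this persists nearby. The positivity condition on Voronoi regions is thus automatic when
`b` lies in the support. -/
theorem voronoiRegion_mem_nhds {γ : Set Plane} (hγ : γ.Finite) (b : Plane) :
    voronoiRegion b γ ∈ nhds b := by
  have : ∀ c ∈ γ, {x : Plane | dist x b ≤ dist x c} ∈ nhds b := by
    intro c _
    by_cases hcb : c = b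
    · subst hcb; simp
    · have h : ∀ᶠ x in nhds b, dist x b < dist x c := by
        refine ContinuousAt.eventually_lt (by fun_prop) (by fun_prop) ?_
        rw [dist_self]
        exact dist_pos.2 (Ne.symm hcb)
      exact h.mono fun x hx => hx.le
  have h2 := (Filter.biInter_mem hγ).2 this
  refine Filter.mem_of_superset h2 fun x hx c hc => ?_
  exact mem_iInter₂.1 hx c hc

theorem segmentUniform_pos {s : Set Plane} {a b : Plane} {r : ℝ} (hr : r ∈ Icc (0 : ℝ) 1)
    (hs : s ∈ nhds (AffineMap.lineMap a b r : Plane)) : 0 < segmentUniform a b s := by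
  obtain ⟨o, hos, ho, hao⟩ := mem_nhds_iff.1 hs
  refine lt_of_lt_of_le ?_ (measure_mono hos)
  have hc : Continuous fun t : ℝ => (AffineMap.lineMap a b t : Plane) :=
    AffineMap.lineMap_continuous
  rw [segmentUniform, Measure.map_apply hc.measurable ho.measurableSet,
    Measure.restrict_apply (hc.measurable ho.measurableSet)]
  have ho' : IsOpen ((fun t : ℝ => (AffineMap.lineMap a b t : Plane)) ⁻¹' o) := ho.preimage hc
  -- The point may be an endpoint of the segment; as a limit of interior parameters it still yields
  -- a nonempty open subset of (0,1).
  rw [← closure_Ioo zero_ne_one] at hr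
  have hne := mem_closure_iff.1 hr _ ho' hao
  exact ((ho'.inter isOpen_Ioo).measure_pos volume hne).trans_le
    (measure_mono (inter_subset_inter_right _ Ioo_subset_Icc_self))

theorem hexUniform_pos {s : Set Plane} {j : Fin 6} (hs : s ∈ nhds (hexVertex j)) :
    0 < hexUniform s := by
  have h := segmentUniform_pos (a := hexVertex j) (b := hexVertex (j + 1)) (s := s) (r := 0)
    (by simp) (by simpa using hs)
  rw [hexUniform, Measure.smul_apply, Measure.finsetSum_apply, smul_eq_mul]
  refine ENNReal.mul_pos (by simp) ?_
  refine (h.trans_le ?_).ne'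
  exact Finset.single_le_sum
    (f := fun j : Fin 6 => segmentUniform (hexVertex j) (hexVertex (j + 1)) s)
    (fun _ _ => zero_le) (Finset.mem_univ j)

theorem triUniform_pos {s : Set Plane} {p : Plane} (hp : p ∈ ({triG, triH, triI} : Set Plane))
    (hs : s ∈ nhds p) : 0 < triUniform s := by
  rw [triUniform, Measure.smul_apply, Measure.add_apply, smul_eq_mul]
  refine ENNReal.mul_pos (by simp) (ne_of_gt ?_)
  rcases hp with rfl | rfl | rfl
  · exact (segmentUniform_pos (a := triG) (b := triI) (r := 0) (by simp)
      (by simpa using hs)).trans_le le_self_add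
  · exact (segmentUniform_pos (a := triH) (b := triI) (r := 0) (by simp)
      (by simpa using hs)).trans_le le_add_self
  · exact (segmentUniform_pos (a := triG) (b := triI) (r := 1) (by simp)
      (by simpa using hs)).trans_le le_self_add

/-! ### The triangle -/

/-- The point of parameter `x` on the segment `GH`. -/
noncomputable def basePoint (x : ℝ) : Plane := AffineMap.lineMap triG triH x

/-- The points with parameters in `X`, together with the vertices of the triangle. -/
noncomputable def triSet (X : Set ℝ) : Set Plane := basePoint '' X ∪ {triG, triH, triI}

/-- The cost of the side `GI`. -/
noncomputable def leftCost (X : Set ℝ) : ℝ := sideCost (triSet X) triG triI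

/-- The distortion error for the uniform distribution on `GI ∪ HI`. -/
noncomputable def totalCost (X : Set ℝ) : ℝ := (leftCost X + leftCost ((1 - ·) '' X)) / 2

theorem sqrt_three_sq : √3 ^ 2 = 3 := Real.sq_sqrt (by norm_num)

theorem basePoint_zero : basePoint 0 = triG := by simp [basePoint]

theorem basePoint_one : basePoint 1 = triH := by simp [basePoint]

theorem basePoint_coord_zero (x : ℝ) : basePoint x 0 = -√3 / 2 + √3 * x := by
  rw [basePoint, plane_lineMap]; simp [triG, triH]; ring

theorem basePoint_coord_one (x : ℝ) : basePoint x 1 = 0 := by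
  rw [basePoint, plane_lineMap]; simp [triG, triH]

theorem dist_sq_basePoint (x t : ℝ) :
    dist (AffineMap.lineMap triG triI t : Plane) (basePoint x) ^ 2 = t ^ 2 - chordGain x t := by
  rw [plane_dist_sq, plane_lineMap, plane_lineMap, basePoint_coord_zero, basePoint_coord_one,
    chordGain]
  simp [triG, triI]
  linear_combination (t ^ 2 / 4 - x * t + x ^ 2) * sqrt_three_sq

theorem dist_sq_triI (t : ℝ) :
    dist (AffineMap.lineMap triG triI t : Plane) triI ^ 2 = t ^ 2 - (2 * t - 1) := by
  rw [plane_dist_sq, plane_lineMap, plane_lineMap]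
  simp [triG, triI]
  linear_combination ((t - 1) ^ 2 / 4) * sqrt_three_sq

/-! ### Bounds for the cost of one side -/

theorem triSet_nonempty (X : Set ℝ) : (triSet X).Nonempty := ⟨triG, by simp [triSet]⟩

theorem integral_sq_sub {g : ℝ → ℝ} (hg : Continuous g) :
    ∫ t in (0 : ℝ)..1, (t ^ 2 - g t) = 1 / 3 - ∫ t in (0 : ℝ)..1, g t := by
  rw [intervalIntegral.integral_sub (Continuous.intervalIntegrable (by fun_prop) _ _)
    (hg.intervalIntegrable _ _), integral_pow]
  norm_num

/-- Any common majorant of the gains bounds the cost from below. Only the points in `L` have to be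
checked: those of parameter at least 1/2, and H, are dominated by the apex gain. -/
theorem le_leftCost {X L : Set ℝ} (hX : X ⊆ L ∪ Icc (1 / 2) 1) {g : ℝ → ℝ} (hg : Continuous g)
    (hI : ∀ t ∈ Icc (0 : ℝ) 1, apexGain t ≤ g t)
    (hL : ∀ x ∈ L, ∀ t ∈ Icc (0 : ℝ) 1, chordGain x t ≤ g t) :
    1 / 3 - ∫ t in (0 : ℝ)..1, g t ≤ leftCost X := by
  rw [← integral_sq_sub hg, leftCost, sideCost]
  refine intervalIntegral.integral_mono_on zero_le_one
    (Continuous.intervalIntegrable (by fun_prop) _ _)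
    ((continuous_infDist_lineMap _ _ _).intervalIntegrable _ _) fun t ht => ?_
  refine le_infDist_sq (triSet_nonempty X) fun y hy => ?_
  have hI' := hI t ht
  have h1 : ∀ x, 1 / 2 ≤ x → t ^ 2 - g t ≤ t ^ 2 - chordGain x t := fun x hx => by
    linarith [chordGain_le_apexGain hx ht.2]
  rcases hy with ⟨x, hx, rfl⟩ | rfl | rfl | rfl
  · rw [dist_sq_basePoint]
    rcases hX hx with hx | hx
    · linarith [hL x hx t ht]
    · exact h1 x hx.1
  -- `triG` is also the start of the segment; only the occurrence as a point of the set is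
  -- rewritten.
  · nth_rw 2 [← basePoint_zero]
    rw [dist_sq_basePoint]
    have : chordGain 0 t = 0 := by simp [chordGain]
    linarith [le_max_left 0 (2 * t - 1), show apexGain t = max 0 (2 * t - 1) from rfl]
  · nth_rw 1 [← basePoint_one]
    rw [dist_sq_basePoint]
    exact h1 1 (by norm_num)
  · rw [dist_sq_triI]
    linarith [le_max_right 0 (2 * t - 1), show apexGain t = max 0 (2 * t - 1) from rfl]

/-- Conversely, a function that lies below one of the available gains at each t bounds the cost from
above; this shows that the optimal values are attained. -/
theorem leftCost_le {X : Set ℝ} {g : ℝ → ℝ} (hg : Continuous g)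
    (h : ∀ t, g t ≤ apexGain t ∨ ∃ x ∈ X, g t ≤ chordGain x t) :
    leftCost X ≤ 1 / 3 - ∫ t in (0 : ℝ)..1, g t := by
  rw [← integral_sq_sub hg, leftCost, sideCost]
  refine intervalIntegral.integral_mono_on zero_le_one
    ((continuous_infDist_lineMap _ _ _).intervalIntegrable _ _)
    (Continuous.intervalIntegrable (by fun_prop) _ _) fun t _ => ?_
  rcases h t with h | ⟨x, hx, h⟩
  · rcases le_max_iff.1 h with h | h
    · have hm : basePoint 0 ∈ triSet X := by simp [triSet, basePoint_zero]
      refine (infDist_sq_le hm).trans ?_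
      rw [dist_sq_basePoint]
      have : chordGain 0 t = 0 := by simp [chordGain]
      linarith
    · have hm : triI ∈ triSet X := by simp [triSet]
      refine (infDist_sq_le hm).trans ?_
      rw [dist_sq_triI]
      linarith
  · refine (infDist_sq_le (show basePoint x ∈ triSet X from Or.inl ⟨x, hx, rfl⟩)).trans ?_
    rw [dist_sq_basePoint]
    linarith

theorem leftCost_ge_of_empty {X : Set ℝ} (hX : X ⊆ Icc (1 / 2) 1) : 1 / 12 ≤ leftCost X := by
  have := le_leftCost (L := ∅) (by simpa using hX) continuous_apexGain (fun _ _ => le_rfl) (by simp)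
  rw [integral_apexGain] at this
  linarith

theorem leftCost_ge {X : Set ℝ} (hX : X ⊆ Icc 0 1) : 1 / 27 ≤ leftCost X := by
  have := le_leftCost (X := X) (L := Icc 0 1) (hX.trans subset_union_left)
    (g := fun t => max (3 / 4 * t ^ 2) (2 * t - 1)) (by fun_prop)
    (fun t _ => max_le_max (by positivity) le_rfl)
    (fun x _ t _ => le_max_of_le_left (chordGain_le_sq x t))
  rw [integral_max_sq] at this
  linarith

theorem leftCost_ge_of_single {X : Set ℝ} {x : ℝ} (h0 : 0 ≤ x) (h1 : x ≤ 1 / 2)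
    (hX : X ⊆ {x} ∪ Icc (1 / 2) 1) : 1 / 12 - singleGain x ≤ leftCost X := by
  have := le_leftCost hX (g := fun t => max (apexGain t) (chordGain x t)) (by fun_prop)
    (fun t _ => le_max_left _ _) (by rintro _ rfl t _; exact le_max_right _ _)
  rw [integral_max_apexGain_chordGain h0 h1] at this
  linarith

theorem integral_pairGain {x y : ℝ} (h0 : 0 ≤ x) (hxy : x ≤ y) (h1 : y ≤ 1 / 2) :
    ∫ t in (0 : ℝ)..1, (max (apexGain t) (chordGain y t) + extraGain x y t) =
      1 / 4 + singleGain y + 3 / 2 * (x * y * (y - x)) := by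
  rw [intervalIntegral.integral_add (Continuous.intervalIntegrable (by fun_prop) _ _)
    (Continuous.intervalIntegrable (by fun_prop) _ _),
    integral_max_apexGain_chordGain (h0.trans hxy) h1, integral_extraGain h0 hxy h1]

theorem leftCost_ge_of_pair {X : Set ℝ} {x y : ℝ} (h0 : 0 ≤ x) (hxy : x ≤ y) (h1 : y ≤ 1 / 2)
    (hX : X ⊆ {x, y} ∪ Icc (1 / 2) 1) :
    1 / 12 - (singleGain y + 3 / 2 * (x * y * (y - x))) ≤ leftCost X := by
  have h := fun t => max_chordGain_le x y t
  have := le_leftCost hX (g := fun t => max (apexGain t) (chordGain y t) + extraGain x y t)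
    (by fun_prop)
    (fun t _ => ((le_max_left _ _).trans (le_max_left _ _)).trans (h t))
    (by
      rintro _ (rfl | rfl) t _
      · exact (le_max_right _ _).trans (h t)
      · exact ((le_max_right _ _).trans (le_max_left _ _)).trans (h t))
  rw [integral_pairGain h0 hxy h1] at this
  linarith

/-- The excess over the apex gain is subadditive in the points. This cruder bound serves for y near
1/2, where y adds almost nothing. -/
theorem leftCost_ge_of_pair' {X : Set ℝ} {x y : ℝ} (hx0 : 0 ≤ x) (hx : x ≤ 1 / 2) (hy0 : 0 ≤ y)
    (hy : y ≤ 1 / 2) (hX : X ⊆ {x, y} ∪ Icc (1 / 2) 1) :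
    1 / 12 - (singleGain x + singleGain y) ≤ leftCost X := by
  have h : ∀ t, apexGain t ≤ max (apexGain t) (chordGain x t) +
      (max (apexGain t) (chordGain y t) - apexGain t) := fun t => by
    linarith [le_max_left (apexGain t) (chordGain x t), le_max_left (apexGain t) (chordGain y t)]
  have := le_leftCost hX (g := fun t => max (apexGain t) (chordGain x t) +
      (max (apexGain t) (chordGain y t) - apexGain t)) (by fun_prop) (fun t _ => h t)
    (by
      intro z hz t _
      rcases hz with rfl | rfl
      · linarith [le_max_right (apexGain t) (chordGain z t),
          le_max_left (apexGain t) (chordGain y t)]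
      · linarith [le_max_right (apexGain t) (chordGain z t),
          le_max_left (apexGain t) (chordGain x t)])
  rw [intervalIntegral.integral_add (Continuous.intervalIntegrable (by fun_prop) _ _)
    (Continuous.intervalIntegrable (by fun_prop) _ _),
    intervalIntegral.integral_sub (Continuous.intervalIntegrable (by fun_prop) _ _)
    (Continuous.intervalIntegrable (by fun_prop) _ _), integral_apexGain,
    integral_max_apexGain_chordGain hx0 hx, integral_max_apexGain_chordGain hy0 hy] at this
  linarith

theorem soloCost_le_leftCost {X L : Set ℝ} (hL : L ⊆ Icc 0 (1 / 2)) (hc : L.ncard = 1)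
    (hX : X ⊆ L ∪ Icc (1 / 2) 1) :
    soloCost ≤ leftCost X ∧ (leftCost X ≤ soloCost → L = {soloParam}) := by
  obtain ⟨x, rfl⟩ := ncard_eq_one.1 hc
  obtain ⟨h0, h1⟩ := hL rfl
  have h := leftCost_ge_of_single h0 h1 hX
  refine ⟨by linarith [singleGain_le h1], fun h2 => ?_⟩
  rw [eq_soloParam_of_le h1 (by linarith)]

theorem pairCost_le_leftCost {X L : Set ℝ} (hL : L ⊆ Icc 0 (1 / 2)) (hc : L.ncard = 2)
    (hX : X ⊆ L ∪ Icc (1 / 2) 1) :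
    pairCost ≤ leftCost X ∧ (leftCost X ≤ pairCost → L = {pairParam, 2 * pairParam}) := by
  obtain ⟨x, y, hxy, hLe⟩ := ncard_eq_two.1 hc
  wlog hlt : x < y generalizing x y
  · exact this y x hxy.symm (by rw [hLe, pair_comm]) (lt_of_le_of_ne (not_lt.1 hlt) hxy.symm)
  subst hLe
  obtain ⟨h0, -⟩ := hL (mem_insert x _)
  obtain ⟨hy0, h1⟩ := hL (mem_insert_of_mem x rfl)
  rcases le_total y (7 / 15) with hy | hy
  · have h := leftCost_ge_of_pair h0 hlt.le h1 hX
    refine ⟨by linarith [pairGain_le (x := x) hy0 hy], fun h2 => ?_⟩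
    obtain ⟨rfl, rfl⟩ := eq_pairParam_of_le (x := x) hy0 hy (by linarith)
    rfl
  -- Here the total gain is at most (1/12 - `soloCost`) + 1/250, about 0.0427, below 1/12 -
  -- `pairCost`, about 0.0434; equality cannot occur.
  · have h := leftCost_ge_of_pair' h0 (hlt.le.trans h1) hy0 h1 hX
    have h2 := singleGain_le (hlt.le.trans h1)
    have h3 := singleGain_le_of_seven_fifteenths_le hy h1
    have h4 := pairCost_bounds.2
    have h5 := soloCost_bounds.1
    exact ⟨by linarith, fun h6 => by linarith⟩

theorem leftCost_le_soloCost {X : Set ℝ} (h : soloParam ∈ X) : leftCost X ≤ soloCost := by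
  have hb := soloParam_bounds
  have := leftCost_le (X := X) (g := fun t => max (apexGain t) (chordGain soloParam t))
    (by fun_prop) fun t => (le_max_iff.1 le_rfl).imp id fun h' => ⟨_, h, h'⟩
  rw [integral_max_apexGain_chordGain (by linarith) (by linarith), singleGain_soloParam] at this
  linarith

theorem leftCost_le_pairCost {X : Set ℝ} (h1 : pairParam ∈ X) (h2 : 2 * pairParam ∈ X) :
    leftCost X ≤ pairCost := by
  have hb := pairParam_bounds
  have := leftCost_le (X := X) (g := fun t => max (apexGain t) (chordGain (2 * pairParam) t) +
      extraGain pairParam (2 * pairParam) t) (by fun_prop) fun t => by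
    rw [← max_chordGain_eq (by linarith) (by linarith)]
    rcases le_max_iff.1 (le_refl (max (max (apexGain t) (chordGain (2 * pairParam) t))
      (chordGain pairParam t))) with h | h
    · exact (le_max_iff.1 h).imp id fun h' => ⟨_, h2, h'⟩
    · exact Or.inr ⟨_, h1, h⟩
  rw [integral_pairGain (by linarith) (by linarith) (by linarith)] at this
  linarith [pairGain_pairParam]

/-- The lower bounds for the cost of one side in terms of the number of points in its half. -/
theorem leftCost_bounds {X L : Set ℝ} (hf : L.Finite) (hL : L ⊆ Icc 0 (1 / 2))
    (hX : X ⊆ L ∪ Icc (1 / 2) 1) :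
    (L.ncard = 0 ∧ 1 / 12 ≤ leftCost X) ∨
    (L.ncard = 1 ∧ soloCost ≤ leftCost X ∧ (leftCost X ≤ soloCost → L = {soloParam})) ∨
    (L.ncard = 2 ∧ pairCost ≤ leftCost X ∧
      (leftCost X ≤ pairCost → L = {pairParam, 2 * pairParam})) ∨
    (3 ≤ L.ncard ∧ 1 / 27 ≤ leftCost X) := by
  have h : L.ncard = 0 ∨ L.ncard = 1 ∨ L.ncard = 2 ∨ 3 ≤ L.ncard := by omega
  rcases h with h | h | h | h
  · left
    rw [ncard_eq_zero hf] at h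
    subst h
    exact ⟨ncard_empty ℝ, leftCost_ge_of_empty (by simpa using hX)⟩
  · exact Or.inr (Or.inl ⟨h, soloCost_le_leftCost hL h hX⟩)
  · exact Or.inr (Or.inr (Or.inl ⟨h, pairCost_le_leftCost hL h hX⟩))
  · refine Or.inr (Or.inr (Or.inr ⟨h, leftCost_ge (hX.trans (union_subset ?_ ?_))⟩))
    · exact hL.trans (Icc_subset_Icc_right (by norm_num))
    · exact Icc_subset_Icc_left (by norm_num)

/-! ### Distribution of the points between the two sides -/

theorem image_one_sub_image (X : Set ℝ) : (1 - ·) '' ((1 - ·) '' X) = X := by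
  rw [image_image]; simp

/-- The two halves of a set of parameters. -/
theorem exists_halves {X : Set ℝ} (hX : X ⊆ Icc 0 1) (hf : X.Finite) :
    ∃ L M : Set ℝ, L.Finite ∧ M.Finite ∧ L ⊆ Icc 0 (1 / 2) ∧ M ⊆ Icc 0 (1 / 2) ∧
      X ⊆ L ∪ Icc (1 / 2) 1 ∧ (1 - ·) '' X ⊆ M ∪ Icc (1 / 2) 1 ∧
      X = L ∪ (1 - ·) '' M ∧ X.ncard = L.ncard + M.ncard := by
  have hinj : Function.Injective fun x : ℝ => 1 - x := sub_right_injective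
  -- The midpoint 1/2 is assigned to the right half only, so the halves are disjoint and their
  -- cardinalities add up.
  refine ⟨X ∩ Iio (1 / 2), (1 - ·) '' (X \ Iio (1 / 2)), hf.inter_of_left _,
    hf.sdiff.image _, fun x hx => ⟨(hX hx.1).1, le_of_lt hx.2⟩, ?_, fun x hx => ?_, ?_, ?_, ?_⟩
  · rintro _ ⟨x, ⟨hx, hx'⟩, rfl⟩
    have := hX hx
    simp only [mem_Iio, not_lt] at hx'
    exact ⟨by linarith [this.2], by linarith⟩
  · by_cases h : x < 1 / 2
    · exact Or.inl ⟨hx, h⟩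
    · exact Or.inr ⟨not_lt.1 h, (hX hx).2⟩
  · rintro _ ⟨x, hx, rfl⟩
    by_cases h : x < 1 / 2
    · exact Or.inr ⟨by linarith, by linarith [(hX hx).1]⟩
    · exact Or.inl ⟨x, ⟨hx, h⟩, rfl⟩
  · rw [image_one_sub_image, inter_union_sdiff]
  · rw [ncard_image_of_injective _ hinj, ncard_inter_add_ncard_sdiff_eq_ncard _ _ hf]

/-- The optimal parameters for three points. -/
noncomputable def tripleParams : Set ℝ := {pairParam, 2 * pairParam, 1 - soloParam}

/-- The optimal parameters for four points. -/
noncomputable def quadrupleParams : Set ℝ :=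
  {pairParam, 2 * pairParam, 1 - 2 * pairParam, 1 - pairParam}

theorem totalCost_image_one_sub (X : Set ℝ) : totalCost ((1 - ·) '' X) = totalCost X := by
  rw [totalCost, totalCost, image_one_sub_image, add_comm]

theorem totalCost_tripleParams_le : totalCost tripleParams ≤ (soloCost + pairCost) / 2 := by
  have h1 := leftCost_le_pairCost (X := tripleParams) (by simp [tripleParams])
    (by simp [tripleParams])
  have h2 := leftCost_le_soloCost (X := (1 - ·) '' tripleParams)
    ⟨1 - soloParam, by simp [tripleParams], by simp⟩
  rw [totalCost]
  linarith

theorem totalCost_quadrupleParams_le : totalCost quadrupleParams ≤ pairCost := by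
  have h1 := leftCost_le_pairCost (X := quadrupleParams) (by simp [quadrupleParams])
    (by simp [quadrupleParams])
  have h2 := leftCost_le_pairCost (X := (1 - ·) '' quadrupleParams)
    ⟨1 - pairParam, by simp [quadrupleParams], by simp⟩
    ⟨1 - 2 * pairParam, by simp [quadrupleParams], by simp⟩
  rw [totalCost]
  linarith

theorem totalCost_three {X : Set ℝ} (hX : X ⊆ Icc 0 1) (hf : X.Finite) (hc : X.ncard ≤ 3) :
    (soloCost + pairCost) / 2 ≤ totalCost X ∧
      (totalCost X = (soloCost + pairCost) / 2 ↔
        X ∈ ({tripleParams, (1 - ·) '' tripleParams} : Set (Set ℝ))) := by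
  obtain ⟨L, M, hLf, hMf, hL, hM, hXL, hXM, hXe, hcard⟩ := exists_halves hX hf
  have hs := soloCost_bounds
  have hp := pairCost_bounds
  have key : (soloCost + pairCost) / 2 ≤ totalCost X ∧
      (totalCost X ≤ (soloCost + pairCost) / 2 →
        X ∈ ({tripleParams, (1 - ·) '' tripleParams} : Set (Set ℝ))) := by
    rw [totalCost]
    -- Of the sixteen distributions, those with too many points contradict the cardinality and the
    -- others are too expensive, except 1 + 2 and 2 + 1, which survive in this order.
    rcases leftCost_bounds hLf hL hXL with ⟨h, h1⟩ | ⟨h, h1, h2⟩ | ⟨h, h1, h2⟩ | ⟨h, h1⟩ <;>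
    rcases leftCost_bounds hMf hM hXM with ⟨k, k1⟩ | ⟨k, k1, k2⟩ | ⟨k, k1, k2⟩ | ⟨k, k1⟩ <;>
    first
    | (exfalso; omega)
    | exact ⟨by linarith, fun h' => by linarith⟩
    | refine ⟨by linarith, fun h' => ?_⟩
    · right
      rw [hXe, h2 (by linarith), k2 (by linarith), tripleParams]
      simp only [image_insert_eq, image_singleton, sub_sub_cancel, singleton_union]
      rw [mem_singleton_iff, insert_comm, pair_comm soloParam, insert_comm]
    · left
      rw [hXe, h2 (by linarith), k2 (by linarith), tripleParams]
      simp only [image_singleton, insert_union, singleton_union]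
  refine ⟨key.1, fun h => key.2 h.le, fun h => le_antisymm ?_ key.1⟩
  rcases h with rfl | rfl
  · exact totalCost_tripleParams_le
  · rw [totalCost_image_one_sub]
    exact totalCost_tripleParams_le

theorem totalCost_four {X : Set ℝ} (hX : X ⊆ Icc 0 1) (hf : X.Finite) (hc : X.ncard ≤ 4) :
    pairCost ≤ totalCost X ∧
      (totalCost X = pairCost ↔ X ∈ ({quadrupleParams} : Set (Set ℝ))) := by
  obtain ⟨L, M, hLf, hMf, hL, hM, hXL, hXM, hXe, hcard⟩ := exists_halves hX hf
  have hs := soloCost_bounds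
  have hp := pairCost_bounds
  have key : pairCost ≤ totalCost X ∧
      (totalCost X ≤ pairCost → X ∈ ({quadrupleParams} : Set (Set ℝ))) := by
    rw [totalCost]
    -- Only 2 + 2 survives. The closest competitor is 3 + 1, whose bound (1/27 + `soloCost`)/2 is
    -- about 0.0408 against 0.0399.
    rcases leftCost_bounds hLf hL hXL with ⟨h, h1⟩ | ⟨h, h1, h2⟩ | ⟨h, h1, h2⟩ | ⟨h, h1⟩ <;>
    rcases leftCost_bounds hMf hM hXM with ⟨k, k1⟩ | ⟨k, k1, k2⟩ | ⟨k, k1, k2⟩ | ⟨k, k1⟩ <;>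
    first
    | (exfalso; omega)
    | exact ⟨by linarith, fun h' => by linarith⟩
    | refine ⟨by linarith, fun h' => ?_⟩
    rw [mem_singleton_iff, hXe, h2 (by linarith), k2 (by linarith), quadrupleParams]
    simp only [image_insert_eq, image_singleton, insert_union, singleton_union]
    rw [pair_comm (1 - pairParam)]
  refine ⟨key.1, fun h => key.2 h.le, fun h => le_antisymm ?_ key.1⟩
  rcases h with rfl
  exact totalCost_quadrupleParams_le

/-! ### Symmetries -/

theorem sideCost_image {f : Plane → Plane} (hf : Isometry f)
    (hl : ∀ a b : Plane, ∀ t : ℝ,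
      f (AffineMap.lineMap a b t) = AffineMap.lineMap (f a) (f b) t)
    (γ : Set Plane) (a b : Plane) : sideCost (f '' γ) (f a) (f b) = sideCost γ a b := by
  simp only [sideCost, ← hl, Metric.infDist_image hf]

/-- The reflection in the second coordinate axis. -/
noncomputable def axisReflection (p : Plane) : Plane := !₂[-p 0, p 1]

theorem isometry_axisReflection : Isometry axisReflection :=
  plane_isometry fun p q => by
    simp [axisReflection]
    ring

theorem axisReflection_lineMap (a b : Plane) (t : ℝ) :
    axisReflection (AffineMap.lineMap a b t) =
      AffineMap.lineMap (axisReflection a) (axisReflection b) t := by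
  apply plane_ext <;> rw [plane_lineMap] <;>
    simp only [axisReflection, plane_lineMap] <;> simp <;> ring

theorem axisReflection_triG : axisReflection triG = triH := by
  apply plane_ext <;> simp [axisReflection, triG, triH]; ring

theorem axisReflection_triH : axisReflection triH = triG := by
  apply plane_ext <;> simp [axisReflection, triG, triH]; ring

theorem axisReflection_triI : axisReflection triI = triI := by
  apply plane_ext <;> simp [axisReflection, triI]

theorem axisReflection_basePoint (x : ℝ) : axisReflection (basePoint x) = basePoint (1 - x) := by
  rw [basePoint, axisReflection_lineMap, axisReflection_triG, axisReflection_triH, basePoint,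
    AffineMap.lineMap_apply_one_sub]

theorem axisReflection_triSet (X : Set ℝ) :
    axisReflection '' triSet X = triSet ((1 - ·) '' X) := by
  simp only [triSet, image_union, image_insert_eq, image_singleton, axisReflection_triG,
    axisReflection_triH, axisReflection_triI, image_image, axisReflection_basePoint]
  rw [insert_comm]

/-- The reflection in the vertical axis carries HI to GI and parameter x to 1 - x, so the right side
costs what the left side costs for the mirrored parameters. -/
theorem distortionError_triSet (X : Set ℝ) :
    distortionError triUniform (triSet X) = totalCost X := by
  rw [distortionError_triUniform (triSet_nonempty X), totalCost, leftCost, leftCost,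
    ← axisReflection_triSet, ← sideCost_image isometry_axisReflection axisReflection_lineMap
      (triSet X) triH, axisReflection_triH, axisReflection_triI]

theorem isometry_isometryU : Isometry isometryU :=
  plane_isometry fun p q => by
    simp [isometryU]
    linear_combination ((p 0 - q 0) ^ 2 + (p 1 - q 1) ^ 2) / 4 * sqrt_three_sq

theorem isometryU_lineMap (a b : Plane) (t : ℝ) :
    isometryU (AffineMap.lineMap a b t) = AffineMap.lineMap (isometryU a) (isometryU b) t := by
  apply plane_ext <;> rw [plane_lineMap] <;>
    simp only [isometryU, plane_lineMap] <;> simp <;> ring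

theorem isometryU_five : isometryU (hexVertex 5) = triG := by
  apply plane_ext <;> simp [isometryU, triG, hexVertex]; ring

theorem isometryU_three : isometryU (hexVertex 3) = triH := by
  apply plane_ext <;> simp [isometryU, triH, hexVertex]
  · ring
  · linear_combination sqrt_three_sq / 4

theorem isometryU_four : isometryU (hexVertex 4) = triI := by
  apply plane_ext <;> simp [isometryU, triI, hexVertex]
  · ring
  · linear_combination sqrt_three_sq / 4

/-! ### The hexagon -/

/-- The point of parameter `x` on the short diagonal. -/
noncomputable def diagPoint (x : ℝ) : Plane := AffineMap.lineMap (hexVertex 5) (hexVertex 3) x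

/-- The points with parameters in `X`, together with the vertices of the hexagon. -/
noncomputable def hexSet (X : Set ℝ) : Set Plane := diagPoint '' X ∪ hexVertices

theorem diagPoint_coord_zero (x : ℝ) : diagPoint x 0 = -1 + 3 / 2 * x := by
  rw [diagPoint, plane_lineMap]; simp [hexVertex]; ring

theorem diagPoint_coord_one (x : ℝ) : diagPoint x 1 = √3 / 2 * x := by
  rw [diagPoint, plane_lineMap]; simp [hexVertex]; ring

theorem isometryU_diagPoint (x : ℝ) : isometryU (diagPoint x) = basePoint x := by
  rw [diagPoint, isometryU_lineMap, isometryU_five, isometryU_three, basePoint]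

theorem hexSet_nonempty (X : Set ℝ) : (hexSet X).Nonempty := ⟨hexVertex 0, Or.inr ⟨0, rfl⟩⟩

theorem hexVertex_injective : Function.Injective hexVertex := by
  have h3 : 0 < √3 := by positivity
  intro i j h
  have h0 : hexVertex i 0 = hexVertex j 0 := by rw [h]
  have h1 : hexVertex i 1 = hexVertex j 1 := by rw [h]
  fin_cases i <;> fin_cases j <;> first
    | rfl
    | (exfalso; simp [hexVertex] at h0; done)
    | (exfalso; simp [hexVertex] at h0; norm_num at h0; done)
    | (exfalso; simp [hexVertex] at h1; done)
    | (exfalso; simp [hexVertex] at h1; linarith)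

theorem ncard_hexVertices : hexVertices.ncard = 6 := by
  rw [hexVertices, ← image_univ, ncard_image_of_injective _ hexVertex_injective, ncard_univ,
    Nat.card_eq_fintype_card, Fintype.card_fin]

theorem finite_hexVertices : hexVertices.Finite := finite_range _

theorem triG_ne_triH : triG ≠ triH := fun h => by
  have h0 : triG 0 = triH 0 := by rw [h]
  have h3 : 0 < √3 := by positivity
  simp [triG, triH] at h0
  linarith

theorem ncard_triVertices : ({triG, triH, triI} : Set Plane).ncard = 3 := by
  refine ncard_eq_three.2 ⟨_, _, _, triG_ne_triH, fun h => ?_, fun h => ?_, rfl⟩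
  · have h1 : triG 1 = triI 1 := by rw [h]
    simp [triG, triI] at h1
  · have h1 : triH 1 = triI 1 := by rw [h]
    simp [triH, triI] at h1

theorem hexVertices_eq : hexVertices = {hexVertex 5, hexVertex 3, hexVertex 4} ∪
    {hexVertex 0, hexVertex 1, hexVertex 2} := by
  refine Subset.antisymm ?_ ?_
  · rintro _ ⟨j, rfl⟩
    fin_cases j <;> simp
  · rintro _ ((rfl | rfl | rfl) | rfl | rfl | rfl) <;> exact ⟨_, rfl⟩

theorem triSet_eq_image (X : Set ℝ) : triSet X =
    isometryU '' (diagPoint '' X ∪ {hexVertex 5, hexVertex 3, hexVertex 4}) := by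
  simp only [triSet, image_union, image_insert_eq, image_singleton, isometryU_five,
    isometryU_three, isometryU_four, image_image, isometryU_diagPoint]

theorem preimage_triSet_union (X : Set ℝ) :
    isometryU ⁻¹' triSet X ∪ hexVertices = hexSet X := by
  rw [triSet_eq_image, preimage_image_eq _ isometry_isometryU.injective, hexSet, hexVertices_eq,
    union_assoc, ← union_assoc {hexVertex 5, hexVertex 3, hexVertex 4}, union_self]

theorem infDist_union_eq_left {S T : Set Plane} {x s : Plane} (hs : s ∈ S)
    (h : ∀ y ∈ T, dist x s ≤ dist x y) : Metric.infDist x (S ∪ T) = Metric.infDist x S := by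
  refine le_antisymm (Metric.infDist_le_infDist_of_subset subset_union_left ⟨s, hs⟩) ?_
  refine (Metric.le_infDist ⟨s, Or.inl hs⟩).2 fun y hy => ?_
  rcases hy with hy | hy
  · exact Metric.infDist_le_dist_of_mem hy
  · exact (Metric.infDist_le_dist_of_mem hs).trans (h y hy)

/-- The vertices `A₁`, `A₂`, `A₃` do not matter on the sides `A₄A₅` and `A₅A₆`. -/
theorem sideCost_hexSet (X : Set ℝ) {j k l : Fin 6}
    (hl : hexVertex l ∈ ({hexVertex 5, hexVertex 3, hexVertex 4} : Set Plane))
    (h : ∀ t ∈ Icc (0 : ℝ) 1, ∀ y ∈ ({hexVertex 0, hexVertex 1, hexVertex 2} : Set Plane),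
      dist (AffineMap.lineMap (hexVertex j) (hexVertex k) t : Plane) (hexVertex l) ^ 2 ≤
        dist (AffineMap.lineMap (hexVertex j) (hexVertex k) t : Plane) y ^ 2) :
    sideCost (hexSet X) (hexVertex j) (hexVertex k) =
      sideCost (triSet X) (isometryU (hexVertex j)) (isometryU (hexVertex k)) := by
  rw [triSet_eq_image, sideCost_image isometry_isometryU isometryU_lineMap, sideCost, sideCost]
  refine intervalIntegral.integral_congr fun t ht => ?_
  rw [uIcc_of_le zero_le_one] at ht
  rw [hexSet, hexVertices_eq, ← union_assoc, infDist_union_eq_left (Or.inr hl)]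
  exact fun y hy => (pow_le_pow_iff_left₀ dist_nonneg dist_nonneg two_ne_zero).1 (h t ht y hy)

theorem sideCost_hexSet_three (X : Set ℝ) :
    sideCost (hexSet X) (hexVertex 3) (hexVertex 4) = sideCost (triSet X) triH triI := by
  rw [sideCost_hexSet X (l := 3) (by simp), isometryU_three, isometryU_four]
  rintro t ⟨h0, h1⟩ y (rfl | rfl | rfl) <;>
    rw [plane_dist_sq, plane_dist_sq, plane_lineMap, plane_lineMap] <;> simp [hexVertex] <;>
    ring_nf <;> (try simp only [sqrt_three_sq]) <;> nlinarith

theorem sideCost_hexSet_four (X : Set ℝ) :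
    sideCost (hexSet X) (hexVertex 4) (hexVertex 5) = sideCost (triSet X) triG triI := by
  rw [sideCost_hexSet X (l := 5) (by simp), isometryU_five, isometryU_four, sideCost_comm]
  rintro t ⟨h0, h1⟩ y (rfl | rfl | rfl) <;>
    rw [plane_dist_sq, plane_dist_sq, plane_lineMap, plane_lineMap] <;> simp [hexVertex] <;>
    ring_nf <;> (try simp only [sqrt_three_sq]) <;> nlinarith

/-- The function t² - `apexGain t` is min(t², (1 - t)²), the squared distance to the nearer
endpoint; the hypothesis says that no point of `γ` is closer. -/
theorem sideCost_eq_one_twelfth {γ : Set Plane} {a b : Plane} (ha : a ∈ γ) (hb : b ∈ γ)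
    (hab : dist a b = 1)
    (h : ∀ t ∈ Icc (0 : ℝ) 1, ∀ y ∈ γ,
      t ^ 2 - apexGain t ≤ dist (AffineMap.lineMap a b t : Plane) y ^ 2) :
    sideCost γ a b = 1 / 12 := by
  have : ∫ t in (0 : ℝ)..1, (t ^ 2 - apexGain t) = 1 / 12 := by
    rw [integral_sq_sub continuous_apexGain, integral_apexGain]; norm_num
  rw [← this, sideCost]
  refine intervalIntegral.integral_congr fun t ht => ?_
  rw [uIcc_of_le zero_le_one] at ht
  refine le_antisymm ?_ (le_infDist_sq ⟨a, ha⟩ (h t ht))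
  have h1 := infDist_sq_le (x := (AffineMap.lineMap a b t : Plane)) ha
  have h2 := infDist_sq_le (x := (AffineMap.lineMap a b t : Plane)) hb
  rw [dist_lineMap_left, hab, mul_one, Real.norm_eq_abs, sq_abs] at h1
  rw [dist_lineMap_right, hab, mul_one, Real.norm_eq_abs, sq_abs] at h2
  simp only [apexGain]
  rcases max_choice 0 (2 * t - 1) with h3 | h3 <;> rw [h3] <;> linarith

theorem dist_hexVertex_succ (j : Fin 6) : dist (hexVertex j) (hexVertex (j + 1)) = 1 := by
  rw [← pow_left_inj₀ dist_nonneg zero_le_one two_ne_zero, plane_dist_sq]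
  fin_cases j <;> simp [hexVertex] <;> ring_nf <;> (try simp only [sqrt_three_sq]) <;> norm_num

theorem sideCost_hexSet_of_ne {X : Set ℝ} (hX : X ⊆ Icc 0 1) {j : Fin 6} (h3 : j ≠ 3)
    (h4 : j ≠ 4) : sideCost (hexSet X) (hexVertex j) (hexVertex (j + 1)) = 1 / 12 := by
  refine sideCost_eq_one_twelfth (Or.inr ⟨_, rfl⟩) (Or.inr ⟨_, rfl⟩) (dist_hexVertex_succ j) ?_
  rintro t ⟨h0, h1⟩ y hy
  have hm1 : 0 ≤ apexGain t := le_max_left _ _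
  have hm2 : 2 * t - 1 ≤ apexGain t := le_max_right _ _
  rw [plane_dist_sq, plane_lineMap, plane_lineMap]
  rcases hy with ⟨x, hx, rfl⟩ | ⟨k, rfl⟩
  · rw [diagPoint_coord_zero, diagPoint_coord_one]
    obtain ⟨hx0, hx1⟩ := hX hx
    fin_cases j <;> simp [hexVertex] at h3 h4 ⊢ <;> ring_nf <;> (try simp only [sqrt_three_sq])
    · nlinarith
    · nlinarith [sq_nonneg (t - x), mul_nonneg hx0 h0]
    · nlinarith
    · nlinarith
  · fin_cases j <;> simp at h3 h4 <;> fin_cases k <;> simp [hexVertex] <;> ring_nf <;>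
      (try simp only [sqrt_three_sq]) <;> nlinarith

theorem distortionError_hexSet {X : Set ℝ} (hX : X ⊆ Icc 0 1) :
    distortionError hexUniform (hexSet X) = totalCost X / 3 + 1 / 18 := by
  rw [distortionError_hexUniform (hexSet_nonempty X), ← distortionError_triSet,
    distortionError_triUniform (triSet_nonempty X), ← sideCost_hexSet_three,
    ← sideCost_hexSet_four, Fin.sum_univ_six, sideCost_hexSet_of_ne hX (j := 0) (by decide)
    (by decide), sideCost_hexSet_of_ne hX (j := 1) (by decide) (by decide),
    sideCost_hexSet_of_ne hX (j := 2) (by decide) (by decide),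
    sideCost_hexSet_of_ne hX (j := 5) (by decide) (by decide)]
  simp only [Fin.reduceAdd]
  ring

/-! ### Optimal sets -/

/-- Common to triangle and hexagon: an injective parametrisation `c` of the constraint preserves
cardinalities, so the problem becomes one on finite subsets of [0,1]. By `hpos` the Voronoi
condition holds for every admissible set and excludes nothing. -/
theorem optimal_of_params {μ : Measure Plane} {S β : Set Plane} {c : ℝ → Plane} {n k : ℕ}
    {val : Set ℝ → ℝ} {v : ℝ} {O : Set (Set ℝ)} (hS : S = c '' Icc 0 1)
    (hc : Function.Injective c) (hn : k + β.ncard = n) (hβ : β.Finite)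
    (hpos : ∀ b ∈ β, ∀ s ∈ nhds b, 0 < μ s)
    (hval : ∀ X ⊆ Icc 0 1, distortionError μ (c '' X ∪ β) = val X)
    (hopt : ∀ X ⊆ Icc 0 1, X.Finite → X.ncard ≤ k → v ≤ val X ∧ (val X = v ↔ X ∈ O))
    (hO : ∀ X ∈ O, X ⊆ Icc 0 1 ∧ X.Finite ∧ X.ncard ≤ k) (hne : O.Nonempty) :
    condConstrainedError μ S β n = v ∧
      ∀ γ, IsCondOptimalSet μ S β n γ ↔ ∃ X ∈ O, γ = c '' X ∪ β := by
  have hparam : ∀ α : Set Plane, α ⊆ S → α.Finite → α.ncard + β.ncard ≤ n →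
      ∃ X ⊆ Icc (0 : ℝ) 1, X.Finite ∧ X.ncard ≤ k ∧ α = c '' X := by
    intro α hα hf hcard
    rw [hS] at hα
    obtain ⟨X, hX, rfl⟩ := subset_image_iff.1 hα
    rw [ncard_image_of_injective _ hc] at hcard
    exact ⟨X, hX, hf.of_finite_image hc.injOn, by omega, rfl⟩
  have hadm : ∀ X ∈ O, c '' X ⊆ S ∧ (c '' X).Finite ∧ (c '' X).ncard + β.ncard ≤ n := by
    intro X hX
    obtain ⟨h1, h2, h3⟩ := hO X hX
    refine ⟨hS ▸ image_mono h1, h2.image _, ?_⟩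
    rw [ncard_image_of_injective _ hc]
    omega
  have hOval : ∀ X ∈ O, distortionError μ (c '' X ∪ β) = v := fun X hX => by
    obtain ⟨h1, h2, h3⟩ := hO X hX
    rw [hval X h1]
    exact (hopt X h1 h2 h3).2.2 hX
  have herr : condConstrainedError μ S β n = v := by
    refine IsLeast.csInf_eq ⟨?_, ?_⟩
    · obtain ⟨X, hX⟩ := hne
      obtain ⟨h1, h2, h3⟩ := hadm X hX
      exact ⟨_, h1, h2, h3, (hOval X hX).symm⟩
    · rintro _ ⟨α, h1, h2, h3, rfl⟩
      obtain ⟨X, hX, hXf, hXc, rfl⟩ := hparam α h1 h2 h3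
      rw [hval X hX]
      exact (hopt X hX hXf hXc).1
  refine ⟨herr, fun γ => ⟨?_, ?_⟩⟩
  · rintro ⟨⟨α, h1, h2, h3, rfl⟩, -, h4⟩
    obtain ⟨X, hX, hXf, hXc, rfl⟩ := hparam α h1 h2 h3
    rw [hval X hX, herr] at h4
    exact ⟨X, (hopt X hX hXf hXc).2.1 h4, rfl⟩
  · rintro ⟨X, hX, rfl⟩
    obtain ⟨h1, h2, h3⟩ := hadm X hX
    exact ⟨⟨_, h1, h2, h3, rfl⟩,
      fun b hb => hpos b hb _ (voronoiRegion_mem_nhds (h2.union hβ) b),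
      by rw [herr, hOval X hX]⟩

theorem basePoint_injective : Function.Injective basePoint :=
  AffineMap.lineMap_injective ℝ triG_ne_triH

theorem diagPoint_injective : Function.Injective diagPoint :=
  AffineMap.lineMap_injective ℝ (hexVertex_injective.ne (by decide))

theorem tri_optimal {n k : ℕ} {v : ℝ} {O : Set (Set ℝ)} (hn : k + 3 = n)
    (hopt : ∀ X ⊆ Icc 0 1, X.Finite → X.ncard ≤ k → v ≤ totalCost X ∧ (totalCost X = v ↔ X ∈ O))
    (hO : ∀ X ∈ O, X ⊆ Icc 0 1 ∧ X.Finite ∧ X.ncard ≤ k) (hne : O.Nonempty) :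
    condConstrainedError triUniform (segment ℝ triG triH) {triG, triH, triI} n = v ∧
      ∀ γ, IsCondOptimalSet triUniform (segment ℝ triG triH) {triG, triH, triI} n γ ↔
        ∃ X ∈ O, γ = triSet X :=
  optimal_of_params (c := basePoint) (segment_eq_image_lineMap ℝ triG triH) basePoint_injective
    (by rw [ncard_triVertices, hn]) (toFinite _) (fun _ hb _ hs => triUniform_pos hb hs)
    (fun X _ => distortionError_triSet X) hopt hO hne

theorem hex_optimal {n k : ℕ} {v : ℝ} {O : Set (Set ℝ)} (hn : k + 6 = n)
    (hopt : ∀ X ⊆ Icc 0 1, X.Finite → X.ncard ≤ k → v ≤ totalCost X ∧ (totalCost X = v ↔ X ∈ O))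
    (hO : ∀ X ∈ O, X ⊆ Icc 0 1 ∧ X.Finite ∧ X.ncard ≤ k) (hne : O.Nonempty) :
    condConstrainedError hexUniform shortDiagonal hexVertices n = v / 3 + 1 / 18 ∧
      ∀ γ, IsCondOptimalSet hexUniform shortDiagonal hexVertices n γ ↔
        ∃ X ∈ O, γ = hexSet X := by
  refine optimal_of_params (c := diagPoint) (val := fun X => totalCost X / 3 + 1 / 18)
    (segment_eq_image_lineMap ℝ _ _) diagPoint_injective (by rw [ncard_hexVertices, hn])
    finite_hexVertices (by rintro _ ⟨j, rfl⟩ s hs; exact hexUniform_pos hs)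
    (fun X hX => distortionError_hexSet hX) (fun X hX hf hc => ?_) hO hne
  obtain ⟨h1, h2⟩ := hopt X hX hf hc
  refine ⟨by linarith, ?_⟩
  rw [← h2]
  constructor <;> intro h <;> linarith

/-! ### Admissibility, mirror images and decimals of the optimal points -/

theorem tripleParams_admissible :
    tripleParams ⊆ Icc 0 1 ∧ tripleParams.Finite ∧ tripleParams.ncard ≤ 3 := by
  have ha := pairParam_bounds
  have hb := soloParam_bounds
  refine ⟨?_, by simp [tripleParams], ?_⟩
  · rintro _ (rfl | rfl | rfl) <;> constructor <;> linarith
  · exact (ncard_insert_le _ _).trans (Nat.succ_le_succ ((ncard_insert_le _ _).trans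
      (Nat.succ_le_succ (ncard_singleton _).le)))

theorem quadrupleParams_admissible :
    quadrupleParams ⊆ Icc 0 1 ∧ quadrupleParams.Finite ∧ quadrupleParams.ncard ≤ 4 := by
  have ha := pairParam_bounds
  refine ⟨?_, by simp [quadrupleParams], ?_⟩
  · rintro _ (rfl | rfl | rfl | rfl) <;> constructor <;> linarith
  · exact (ncard_insert_le _ _).trans (Nat.succ_le_succ
      ((ncard_insert_le _ _).trans (Nat.succ_le_succ ((ncard_insert_le _ _).trans
      (Nat.succ_le_succ (ncard_singleton _).le)))))

theorem image_one_sub_admissible {X : Set ℝ} {k : ℕ}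
    (h : X ⊆ Icc 0 1 ∧ X.Finite ∧ X.ncard ≤ k) :
    (1 - ·) '' X ⊆ Icc 0 1 ∧ ((1 - ·) '' X).Finite ∧ ((1 - ·) '' X).ncard ≤ k := by
  refine ⟨?_, h.2.1.image _, (ncard_image_le h.2.1).trans h.2.2⟩
  rintro _ ⟨x, hx, rfl⟩
  have := h.1 hx
  exact ⟨by linarith [this.2], by linarith [this.1]⟩

theorem diagReflection_diagPoint (x : ℝ) : diagReflection (diagPoint x) = diagPoint (1 - x) := by
  apply plane_ext
  · simp only [diagReflection, diagPoint_coord_zero, diagPoint_coord_one]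
    simp
    linear_combination (-x / 4) * sqrt_three_sq
  · simp only [diagReflection, diagPoint_coord_zero, diagPoint_coord_one]
    simp
    ring

/-- Indices are taken modulo 6; the fixed vertices 1 and 4, that is A₂ and A₅, lie on the axis. -/
theorem diagReflection_hexVertex (j : Fin 6) :
    diagReflection (hexVertex j) = hexVertex (2 - j) := by
  fin_cases j <;> apply plane_ext <;> simp [diagReflection, hexVertex] <;> ring_nf <;>
    (try simp only [sqrt_three_sq]) <;> norm_num

theorem diagReflection_hexSet (X : Set ℝ) :
    diagReflection '' hexSet X = hexSet ((1 - ·) '' X) := by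
  have hv : diagReflection '' hexVertices = hexVertices := by
    rw [hexVertices, ← range_comp]
    have : diagReflection ∘ hexVertex = hexVertex ∘ Equiv.subLeft (2 : Fin 6) :=
      funext diagReflection_hexVertex
    rw [this, EquivLike.range_comp]
  simp only [hexSet, image_union, hv, image_image, diagReflection_diagPoint]

theorem hexSet_tripleParams : hexSet tripleParams = hexVertices ∪
    {diagPoint pairParam, diagPoint (2 * pairParam), diagPoint (1 - soloParam)} := by
  rw [hexSet, tripleParams, union_comm, image_insert_eq, image_pair]

theorem hexSet_quadrupleParams : hexSet quadrupleParams = hexVertices ∪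
    {diagPoint pairParam, diagPoint (2 * pairParam), diagPoint (1 - 2 * pairParam),
      diagPoint (1 - pairParam)} := by
  rw [hexSet, quadrupleParams, union_comm, image_insert_eq, image_insert_eq, image_pair]

/-- Both families are indexed by the same parameter sets `O`, and `preimage_triSet_union` matches
them one by one. -/
theorem optimal_hex_iff_tri {m n : ℕ} {O : Set (Set ℝ)}
    (hP : ∀ γ, IsCondOptimalSet hexUniform shortDiagonal hexVertices n γ ↔ ∃ X ∈ O, γ = hexSet X)
    (hQ : ∀ γ, IsCondOptimalSet triUniform (segment ℝ triG triH) {triG, triH, triI} m γ ↔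
      ∃ X ∈ O, γ = triSet X) (α : Set Plane) :
    IsCondOptimalSet hexUniform shortDiagonal hexVertices n α ↔
      ∃ γ : Set Plane,
        IsCondOptimalSet triUniform (segment ℝ triG triH) {triG, triH, triI} m γ ∧
        α = isometryU ⁻¹' γ ∪ hexVertices := by
  simp only [hP, hQ]
  constructor
  · rintro ⟨X, hX, rfl⟩
    exact ⟨_, ⟨X, hX, rfl⟩, (preimage_triSet_union X).symm⟩
  · rintro ⟨_, ⟨X, hX, rfl⟩, rfl⟩
    exact ⟨X, hX, preimage_triSet_union X⟩

/-- Decimals of a point of the diagonal, from bounds for its parameter. -/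
theorem roundsTo_diagPoint {x u v lo hi : ℝ} (hlo : lo < x) (hhi : x < hi) (h0 : 0 < lo)
    (hu : |-1 + 3 / 2 * lo - u| < 5 / 10 ^ 7 ∧ |-1 + 3 / 2 * hi - u| < 5 / 10 ^ 7)
    (hv : v - 5 / 10 ^ 7 < 1.732050807 / 2 * lo ∧ 1.732050808 / 2 * hi < v + 5 / 10 ^ 7) :
    RoundsTo (diagPoint x) u v := by
  have h3 := sqrt_three_bounds
  rw [RoundsTo, diagPoint_coord_zero, diagPoint_coord_one]
  have h1 : 1.732050807 / 2 * lo < √3 / 2 * x :=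
    mul_lt_mul'' (by linarith) hlo (by norm_num) h0.le
  have h2 : √3 / 2 * x < 1.732050808 / 2 * hi :=
    mul_lt_mul'' (by linarith) hhi (by positivity) (h0.trans hlo).le
  rw [abs_lt, abs_lt] at hu
  rw [abs_lt, abs_lt]
  refine ⟨⟨?_, ?_⟩, ?_, ?_⟩ <;> linarith [hu.1.1, hu.1.2, hu.2.1, hu.2.2, hv.1, hv.2]

theorem soloParam_approx : 0.2113248653 < soloParam ∧ soloParam < 0.2113248656 := by
  unfold soloParam
  constructor <;> linarith [sqrt_three_bounds.1, sqrt_three_bounds.2]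

theorem pairParam_approx : 0.1307915937 < pairParam ∧ pairParam < 0.1307915939 := by
  unfold pairParam
  constructor <;> linarith [sqrt_seven_bounds.1, sqrt_seven_bounds.2]

theorem roundsTo_pair_one : RoundsTo (diagPoint pairParam) (-0.803813) 0.113269 := by
  have h := pairParam_approx
  refine roundsTo_diagPoint h.1 h.2 ?_ ?_ ?_ <;> norm_num [abs_lt]

theorem roundsTo_pair_two : RoundsTo (diagPoint (2 * pairParam)) (-0.607625) 0.226538 := by
  have h := pairParam_approx
  refine roundsTo_diagPoint (lo := 0.2615831874) (hi := 0.2615831878) (by linarith) (by linarith)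
    ?_ ?_ ?_ <;> norm_num [abs_lt]

theorem roundsTo_solo : RoundsTo (diagPoint (1 - soloParam)) 0.183013 0.683013 := by
  have h := soloParam_approx
  refine roundsTo_diagPoint (lo := 0.7886751344) (hi := 0.7886751347) (by linarith) (by linarith)
    ?_ ?_ ?_ <;> norm_num [abs_lt]

theorem roundsTo_pair_three :
    RoundsTo (diagPoint (1 - 2 * pairParam)) 0.107625 0.639488 := by
  have h := pairParam_approx
  refine roundsTo_diagPoint (lo := 0.7384168122) (hi := 0.7384168126) (by linarith) (by linarith)
    ?_ ?_ ?_ <;> norm_num [abs_lt]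

theorem roundsTo_pair_four : RoundsTo (diagPoint (1 - pairParam)) 0.303813 0.752757 := by
  have h := pairParam_approx
  refine roundsTo_diagPoint (lo := 0.8692084061) (hi := 0.8692084063) (by linarith) (by linarith)
    ?_ ?_ ?_ <;> norm_num [abs_lt]

theorem mainTheorem8 :
    -- nine points
    ((∃ p₁ p₂ p₃ : Plane,
        RoundsTo p₁ (-0.803813) 0.113269 ∧ RoundsTo p₂ (-0.607625) 0.226538 ∧
        RoundsTo p₃ 0.183013 0.683013 ∧
        ∀ α : Set Plane, IsCondOptimalSet hexUniform shortDiagonal hexVertices 9 α ↔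
          (α = hexVertices ∪ {p₁, p₂, p₃} ∨
            α = diagReflection '' (hexVertices ∪ {p₁, p₂, p₃}))) ∧
      (∀ α : Set Plane, IsCondOptimalSet hexUniform shortDiagonal hexVertices 9 α ↔
        ∃ γ : Set Plane,
          IsCondOptimalSet triUniform (segment ℝ triG triH) {triG, triH, triI} 6 γ ∧
          α = isometryU ⁻¹' γ ∪ hexVertices) ∧
      condConstrainedError hexUniform shortDiagonal hexVertices 9 =
        condConstrainedError triUniform (segment ℝ triG triH) {triG, triH, triI} 6 / 3 + 1 / 18 ∧
      |condConstrainedError triUniform (segment ℝ triG triH) {triG, triH, triI} 6 - 0.0422866|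
        < 5 / 10 ^ 8 ∧
      |condConstrainedError hexUniform shortDiagonal hexVertices 9 - 0.0696511| < 5 / 10 ^ 8) ∧
    -- ten points
    ((∃ q₁ q₂ q₃ q₄ : Plane,
        RoundsTo q₁ (-0.803813) 0.113269 ∧ RoundsTo q₂ (-0.607625) 0.226538 ∧
        RoundsTo q₃ 0.107625 0.639488 ∧ RoundsTo q₄ 0.303813 0.752757 ∧
        ∀ α : Set Plane, IsCondOptimalSet hexUniform shortDiagonal hexVertices 10 α ↔
          α = hexVertices ∪ {q₁, q₂, q₃, q₄}) ∧
      (∀ α : Set Plane, IsCondOptimalSet hexUniform shortDiagonal hexVertices 10 α ↔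
        ∃ γ : Set Plane,
          IsCondOptimalSet triUniform (segment ℝ triG triH) {triG, triH, triI} 7 γ ∧
          α = isometryU ⁻¹' γ ∪ hexVertices) ∧
      condConstrainedError hexUniform shortDiagonal hexVertices 10 =
        condConstrainedError triUniform (segment ℝ triG triH) {triG, triH, triI} 7 / 3 + 1 / 18 ∧
      |condConstrainedError triUniform (segment ℝ triG triH) {triG, triH, triI} 7 - 0.0399150|
        < 5 / 10 ^ 8 ∧
      |condConstrainedError hexUniform shortDiagonal hexVertices 10 - 0.0688606| < 5 / 10 ^ 8) := by
  have hs := soloCost_bounds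
  have hp := pairCost_bounds
  have hO3 : ∀ X ∈ ({tripleParams, (1 - ·) '' tripleParams} : Set (Set ℝ)),
      X ⊆ Icc 0 1 ∧ X.Finite ∧ X.ncard ≤ 3 := by
    rintro _ (rfl | rfl)
    · exact tripleParams_admissible
    · exact image_one_sub_admissible tripleParams_admissible
  have hO4 : ∀ X ∈ ({quadrupleParams} : Set (Set ℝ)),
      X ⊆ Icc 0 1 ∧ X.Finite ∧ X.ncard ≤ 4 := by
    rintro _ rfl
    exact quadrupleParams_admissible
  obtain ⟨hQ6, hQ6'⟩ := tri_optimal (n := 6) rfl (fun _ => totalCost_three) hO3 ⟨_, Or.inl rfl⟩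
  obtain ⟨hP9, hP9'⟩ := hex_optimal (n := 9) rfl (fun _ => totalCost_three) hO3 ⟨_, Or.inl rfl⟩
  obtain ⟨hQ7, hQ7'⟩ := tri_optimal (n := 7) rfl (fun _ => totalCost_four) hO4 ⟨_, rfl⟩
  obtain ⟨hP10, hP10'⟩ := hex_optimal (n := 10) rfl (fun _ => totalCost_four) hO4 ⟨_, rfl⟩
  -- The unnamed witnesses are the diagonal points at `pairParam`, `2 * pairParam`, `1 - soloParam`
  -- for nine points, and at `pairParam`, `2 * pairParam` and their mirror parameters for ten.
  refine ⟨⟨⟨_, _, _, roundsTo_pair_one, roundsTo_pair_two, roundsTo_solo, fun α => ?_⟩,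
    optimal_hex_iff_tri hP9' hQ6', by rw [hP9, hQ6], ?_, ?_⟩,
    ⟨_, _, _, _, roundsTo_pair_one, roundsTo_pair_two, roundsTo_pair_three, roundsTo_pair_four,
      fun α => ?_⟩,
    optimal_hex_iff_tri hP10' hQ7', by rw [hP10, hQ7], ?_, ?_⟩
  · rw [hP9' α, ← hexSet_tripleParams, diagReflection_hexSet]
    simp
  · rw [hQ6, abs_lt]
    constructor <;> linarith
  · rw [hP9, abs_lt]
    constructor <;> linarith
  · rw [hP10' α, ← hexSet_quadrupleParams]
    simp
  · rw [hQ7, abs_lt]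
    constructor <;> linarith
  · rw [hP10, abs_lt]
    constructor <;> linarith
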